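/- Let $(M,g)$ be a connected Hausdorff smooth $n$-dimensional pseudo-Riemannian manifold of arbitrary signature, with Riemann tensor $R_{abc}{}^{m}$ of its Levi-Civita connection. A vector field $u$ is called Riemann compatible if $$\bigl(u_a R_{bcl}{}^{m}+u_b R_{cal}{}^{m}+u_c R_{abl}{}^{m}\bigr)u_m=0 .$$ Let $X(1),\dots,X(n)$ be vector fields on $M$ (no continuity is needed) that form an orthonormal basis of the tangent space at every point: $X(a)_kX(b)^k=\pm\delta_{ab}$. If $X(3),\dots,X(n)$ are Riemann compatible, then all Pontryagin forms of $(M,g)$ vanish identically. That is, for every $k\ge 1$ the form $p_k$, the component of degree $4k$ of $\det\bigl(I+\tfrac{1}{2\pi}\Omega\bigr)$, is zero, where $\Omega=(\Omega^i{}_j)$ is the matrix of curvature two-forms in any basis of the tangent space; and, in the trace normalization, $\operatorname{tr}(\Omega^{\wedge 2k})=0$ for every $k\ge1$. -/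

import Mathlib

open scoped Manifold ContDiff

noncomputable section

/-- A smooth pseudo-Riemannian metric, of arbitrary signature, on an `n`-dimensional smooth
manifold `M`. -/
structure PseudoRiemannianMetric (n : ℕ) (M : Type*) [TopologicalSpace M]
    [ChartedSpace (EuclideanSpace ℝ (Fin n)) M] [IsManifold (𝓡 n) ∞ M] where
  /-- The scalar product on each tangent space. -/
  val (x : M) : TangentSpace (𝓡 n) x →L[ℝ] TangentSpace (𝓡 n) x →L[ℝ] ℝ
  symm (x : M) (v w : TangentSpace (𝓡 n) x) : val x v w = val x w v
  nondegenerate (x : M) (v : TangentSpace (𝓡 n) x) (hv : ∀ w, val x v w = 0) : v = 0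
  contMDiff : ContMDiff (𝓡 n)
    ((𝓡 n).prod 𝓘(ℝ, EuclideanSpace ℝ (Fin n) →L[ℝ] EuclideanSpace ℝ (Fin n) →L[ℝ] ℝ)) ∞
    (fun x : M ↦ Bundle.TotalSpace.mk'
      (EuclideanSpace ℝ (Fin n) →L[ℝ] EuclideanSpace ℝ (Fin n) →L[ℝ] ℝ) x (val x))

/-! ### Christoffel symbols and curvature of a matrix-valued function on an open set of `ℝⁿ` -/

section Coordinates

variable {n : ℕ}

/-- The partial derivative `∂ᵢ f` at `y`. -/
def partialDeriv (i : Fin n) (f : EuclideanSpace ℝ (Fin n) → ℝ)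
    (y : EuclideanSpace ℝ (Fin n)) : ℝ :=
  fderiv ℝ f y (EuclideanSpace.single i 1)

/-- The Christoffel symbol
`Γᵏᵢⱼ = ½ gᵏˡ (∂ᵢ gⱼₗ + ∂ⱼ gᵢₗ - ∂ₗ gᵢⱼ)` of the Levi-Civita connection of `G = (gᵢⱼ)`. -/
def christoffel (G : EuclideanSpace ℝ (Fin n) → Matrix (Fin n) (Fin n) ℝ) (k i j : Fin n)
    (y : EuclideanSpace ℝ (Fin n)) : ℝ :=
  (1 / 2 : ℝ) * ∑ l, (G y)⁻¹ k l *
    (partialDeriv i (fun z ↦ G z j l) y + partialDeriv j (fun z ↦ G z i l) y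
      - partialDeriv l (fun z ↦ G z i j) y)

/-- The component `Rᵢⱼₖˡ` of the Riemann tensor of `G`, where
`(∇ᵢ ∇ⱼ - ∇ⱼ ∇ᵢ) ∂ₖ = ∑ₗ Rᵢⱼₖˡ ∂ₗ`. -/
def riemannCoord (G : EuclideanSpace ℝ (Fin n) → Matrix (Fin n) (Fin n) ℝ) (i j k l : Fin n)
    (y : EuclideanSpace ℝ (Fin n)) : ℝ :=
  partialDeriv i (christoffel G l j k) y - partialDeriv j (christoffel G l i k) y
    + ∑ m, (christoffel G m j k y * christoffel G l i m y
      - christoffel G m i k y * christoffel G l j m y)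

end Coordinates

/-- The wedge product `α₀ ∧ ⋯ ∧ αₘ₋₁` of `m` two-forms on `V`, evaluated at `2m` vectors: the
sum `2⁻ᵐ ∑_σ sign σ ∏ᵢ αᵢ(v_{σ(2i)}, v_{σ(2i+1)})` over the permutations `σ` of the arguments.
The equivalence `finProdFinEquiv` sends `(i, r)` to `2 i + r`. -/
def wedgeTwoForms {V : Type*} {m : ℕ} (α : Fin m → V → V → ℝ) (v : Fin (m * 2) → V) : ℝ :=
  (1 / 2 ^ m : ℝ) * ∑ σ : Equiv.Perm (Fin (m * 2)), ((Equiv.Perm.sign σ : ℤ) : ℝ) *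
    ∏ i : Fin m, α i (v (σ (finProdFinEquiv (i, 0)))) (v (σ (finProdFinEquiv (i, 1))))

namespace PseudoRiemannianMetric

variable {n : ℕ} {M : Type*} [TopologicalSpace M] [ChartedSpace (EuclideanSpace ℝ (Fin n)) M]
  [IsManifold (𝓡 n) ∞ M]

/-- The basis `∂₁, …, ∂ₙ` of the tangent space at `x` given by the preferred chart at `x`.
By definition the tangent space at `x` is `ℝⁿ`, a tangent vector being represented by its
coordinates in that chart. -/
def coordBasis (x : M) : Module.Basis (Fin n) ℝ (TangentSpace (𝓡 n) x) :=
  (EuclideanSpace.basisFun (Fin n) ℝ).toBasis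

/-- The matrix `gᵢⱼ = g(∂ᵢ, ∂ⱼ)` of the metric in the preferred chart `φ` at `x`, as a function
of the coordinates `y` (meaningful for `y` in the target of `φ`); here `∂ᵢ` is the image of the
`i`-th standard vector under the differential of `φ⁻¹` at `y`. -/
def coordMatrix (g : PseudoRiemannianMetric n M) (x : M) (y : EuclideanSpace ℝ (Fin n)) :
    Matrix (Fin n) (Fin n) ℝ :=
  Matrix.of fun i j ↦
    g.val ((extChartAt (𝓡 n) x).symm y)
      (mfderiv 𝓘(ℝ, EuclideanSpace ℝ (Fin n)) (𝓡 n) (extChartAt (𝓡 n) x).symm y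
        (EuclideanSpace.single i 1 : EuclideanSpace ℝ (Fin n)))
      (mfderiv 𝓘(ℝ, EuclideanSpace ℝ (Fin n)) (𝓡 n) (extChartAt (𝓡 n) x).symm y
        (EuclideanSpace.single j 1 : EuclideanSpace ℝ (Fin n)))

/-- The curvature endomorphism `R(u, v) : w ↦ ∑ uⁱ vʲ wᵏ Rᵢⱼₖˡ ∂ₗ` of the tangent space at `x`,
for the Levi-Civita connection of `g`. -/
def curvature (g : PseudoRiemannianMetric n M) (x : M) (u v : TangentSpace (𝓡 n) x) :
    Module.End ℝ (TangentSpace (𝓡 n) x) :=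
  Matrix.toLin (coordBasis x) (coordBasis x) (Matrix.of fun l k ↦ ∑ i, ∑ j,
    (coordBasis x).repr u i * (coordBasis x).repr v j *
      riemannCoord (g.coordMatrix x) i j k l (extChartAt (𝓡 n) x x))

/-- The tangent vector `u` at `x` is Riemann compatible:
`(uₐ R_{bcl}ᵐ + u_b R_{cal}ᵐ + u_c R_{abl}ᵐ) uₘ = 0`. -/
def RiemannCompatibleAt (g : PseudoRiemannianMetric n M) (x : M) (u : TangentSpace (𝓡 n) x) :
    Prop :=
  ∀ a b c l : TangentSpace (𝓡 n) x,
    g.val x u a * g.val x u (g.curvature x b c l) + g.val x u b * g.val x u (g.curvature x c a l)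
      + g.val x u c * g.val x u (g.curvature x a b l) = 0

/-- The vector field `u` is Riemann compatible. -/
def RiemannCompatible (g : PseudoRiemannianMetric n M) (u : Π x : M, TangentSpace (𝓡 n) x) :
    Prop :=
  ∀ x, g.RiemannCompatibleAt x (u x)

/-- The vector fields `X₁, …, Xₙ` form an orthonormal basis of the tangent space at each point:
`g(X_a, X_b) = 0` for `a ≠ b` and `g(X_a, X_a) = ±1`. -/
def IsOrthonormalFrame (g : PseudoRiemannianMetric n M)
    (X : Fin n → Π x : M, TangentSpace (𝓡 n) x) : Prop :=
  ∀ x a b, if a = b then g.val x (X a x) (X b x) = 1 ∨ g.val x (X a x) (X b x) = -1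
    else g.val x (X a x) (X b x) = 0

/-- The curvature two-form `Ωⁱⱼ` at `x` with respect to a basis `e` of the tangent space:
`R(u, v) eⱼ = ∑ᵢ Ωⁱⱼ(u, v) eᵢ`. -/
def curvatureForm (g : PseudoRiemannianMetric n M) (x : M)
    (e : Module.Basis (Fin n) ℝ (TangentSpace (𝓡 n) x)) (i j : Fin n)
    (u v : TangentSpace (𝓡 n) x) : ℝ :=
  e.repr (g.curvature x u v (e j)) i

/-- The `k`-th Pontryagin form `pₖ` at `x`, the component of degree `4k` of `det (1 + Ω / 2π)`:
`(2π)^{-2k}` times the sum of the principal `2k × 2k` minors of the matrix `Ω` of curvature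
two-forms in a basis `e` of the tangent space, products being wedge products. The value does not
depend on `e`. The principal minors are indexed by increasing maps `s` from `Fin (2k)` to
`Fin n`. -/
def pontryaginForm (g : PseudoRiemannianMetric n M) (k : ℕ) (x : M)
    (e : Module.Basis (Fin n) ℝ (TangentSpace (𝓡 n) x))
    (v : Fin (2 * k * 2) → TangentSpace (𝓡 n) x) : ℝ :=
  (1 / (2 * Real.pi) ^ (2 * k) : ℝ) * ∑ s : Fin (2 * k) ↪o Fin n, ∑ τ : Equiv.Perm (Fin (2 * k)),
    ((Equiv.Perm.sign τ : ℤ) : ℝ) *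
      wedgeTwoForms (fun a ↦ g.curvatureForm x e (s a) (s (τ a))) v

/-- The `k`-th Pontryagin form in its trace normalization, `tr (Ω ∧ ⋯ ∧ Ω)` with `2k` factors:
the form of degree `4k`
`2^{-2k} ∑_σ sign σ tr (R(v_{σ(0)}, v_{σ(1)}) ∘ ⋯ ∘ R(v_{σ(4k-2)}, v_{σ(4k-1)}))`. -/
def pontryaginTraceForm (g : PseudoRiemannianMetric n M) (k : ℕ) (x : M)
    (v : Fin (2 * k * 2) → TangentSpace (𝓡 n) x) : ℝ :=
  (1 / 2 ^ (2 * k) : ℝ) * ∑ σ : Equiv.Perm (Fin (2 * k * 2)), ((Equiv.Perm.sign σ : ℤ) : ℝ) *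
    LinearMap.trace ℝ (TangentSpace (𝓡 n) x) (List.ofFn fun i : Fin (2 * k) ↦
      g.curvature x (v (σ (finProdFinEquiv (i, 0)))) (v (σ (finProdFinEquiv (i, 1))))).prod

end PseudoRiemannianMetric

end

open Equiv Finset

/-! The argument is pointwise, in the orthonormal basis `E` with dual coframe `e`. Inserting `E p`
into the compatibility identity gives `Ω^p_j = e^p ∧ β` for every `p ≥ 2`, and skewness gives the
same factor in `Ω^j_p`. For the two remaining indices, `R(E j, E i)` preserves the plane they span,
so pair symmetry forces `Ω^i_j` to be a multiple of `e^i ∧ e^j` (`apply_curvature_of_small`).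

Both kinds of Pontryagin form are sums of products `∏ Ω (s a) (s (τ a))` with `τ` a permutation.
Pick `a` with `s a ≥ 2`, or any `a` if there is none: the factors at `a` and `τ⁻¹ a` both contain
`e^{s a}`, so their wedge is zero; if `τ` fixes `a`, the factor is a vanishing diagonal entry
(`wedgeTwoForms_cycle_eq_zero`). An arbitrary basis reduces to `E` by
`sum_principal_minors_basis_independent`. The symmetries of `R` are derived from Christoffel
symbols. -/

theorem sum_sign_mul_eq_zero_of_swap_invariant {N : ℕ} (f : Perm (Fin N) → ℝ) {p q : Fin N}
    (hpq : p ≠ q) (hf : ∀ σ, f (σ * swap p q) = f σ) :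
    ∑ σ : Perm (Fin N), ((Perm.sign σ : ℤ) : ℝ) * f σ = 0 := by
  have h := Equiv.sum_comp (Equiv.mulRight (swap p q))
    (fun σ : Perm (Fin N) ↦ ((Perm.sign σ : ℤ) : ℝ) * f σ)
  simp only [Equiv.coe_mulRight, hf, Perm.sign_mul, Perm.sign_swap hpq] at h
  simp only [mul_neg, mul_one, Units.val_neg, Int.cast_neg, neg_mul, sum_neg_distrib] at h
  linarith

/-! ### Vanishing of wedge products of two-forms. -/

section Wedge

variable {V : Type*} {m : ℕ}

/-- The two-form `α` is the wedge product of the one-form `e` with some one-form. -/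
def IsWedgeMultiple (e : V → ℝ) (α : V → V → ℝ) : Prop :=
  ∃ β : V → ℝ, ∀ u w, α u w = e u * β w - e w * β u

/-- Exchanging the two slots fed to `e` fixes the product and flips the sign. The free slots `r`,
`s` cover all four terms of `(e ∧ β) ∧ (e ∧ γ)`. -/
theorem sum_sign_mul_common_factor_eq_zero (α : Fin m → V → V → ℝ) (v : Fin (m * 2) → V)
    {i j : Fin m} (hij : i ≠ j) (e β γ : V → ℝ) {r r' s s' : Fin 2} (hr : r ≠ r') (hs : s ≠ s') :
    ∑ σ : Perm (Fin (m * 2)), ((Perm.sign σ : ℤ) : ℝ) *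
      (e (v (σ (finProdFinEquiv (i, r)))) * β (v (σ (finProdFinEquiv (i, r')))) *
        (e (v (σ (finProdFinEquiv (j, s)))) * γ (v (σ (finProdFinEquiv (j, s'))))) *
        ∏ x ∈ (univ.erase i).erase j,
          α x (v (σ (finProdFinEquiv (x, 0)))) (v (σ (finProdFinEquiv (x, 1))))) = 0 := by
  have hne : ∀ {x y : Fin m × Fin 2}, x ≠ y → finProdFinEquiv x ≠ finProdFinEquiv y :=
    fun h h' ↦ h (finProdFinEquiv.injective h')
  refine sum_sign_mul_eq_zero_of_swap_invariant _
    (p := finProdFinEquiv (i, r)) (q := finProdFinEquiv (j, s)) (hne (by simp [hij])) fun σ ↦ ?_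
  simp only [Perm.mul_apply, swap_apply_left, swap_apply_right]
  rw [swap_apply_of_ne_of_ne (hne (by simp [hr.symm])) (hne (by simp [hij])),
    swap_apply_of_ne_of_ne (hne (by simp [hij.symm])) (hne (by simp [hs.symm]))]
  congr 1
  · ring
  · refine prod_congr rfl fun x hx ↦ ?_
    simp only [mem_erase, mem_univ, and_true] at hx
    rw [swap_apply_of_ne_of_ne (hne (by simp [hx.2])) (hne (by simp [hx.1])),
      swap_apply_of_ne_of_ne (hne (by simp [hx.2])) (hne (by simp [hx.1]))]

theorem wedgeTwoForms_eq_zero_of_common_factor (α : Fin m → V → V → ℝ) (v : Fin (m * 2) → V)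
    {i j : Fin m} (hij : i ≠ j) (e : V → ℝ) (hi : IsWedgeMultiple e (α i))
    (hj : IsWedgeMultiple e (α j)) : wedgeTwoForms α v = 0 := by
  obtain ⟨β, hβ⟩ := hi
  obtain ⟨γ, hγ⟩ := hj
  have h (r r' s s' : Fin 2) (hr : r ≠ r') (hs : s ≠ s') :=
    sum_sign_mul_common_factor_eq_zero α v hij e β γ hr hs
  have h01 : (0 : Fin 2) ≠ 1 := by decide
  have h1 := h 0 1 0 1 h01 h01
  have h2 := h 0 1 1 0 h01 h01.symm
  have h3 := h 1 0 0 1 h01.symm h01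
  have h4 := h 1 0 1 0 h01.symm h01.symm
  unfold wedgeTwoForms
  rw [mul_eq_zero]
  right
  -- The four null sums are removed with the signs `+ - - +` of the expanded product; the last `h1`
  -- restores the right-hand zero, which `← h1` also rewrote.
  rw [← sub_zero (∑ σ : Perm (Fin (m * 2)), _), ← h1, ← add_zero (∑ σ : Perm (Fin (m * 2)), _ - _),
    ← h2, ← add_zero (_ + _), ← h3, ← sub_zero (_ + _), ← h4, ← sum_sub_distrib, ← sum_add_distrib,
    ← sum_add_distrib, ← sum_sub_distrib, h1]
  refine sum_eq_zero fun σ _ ↦ ?_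
  rw [← mul_prod_erase univ _ (mem_univ i),
    ← mul_prod_erase (univ.erase i) _ (mem_erase.2 ⟨hij.symm, mem_univ j⟩), hβ, hγ]
  ring

theorem wedgeTwoForms_eq_zero_of_factor_eq_zero (α : Fin m → V → V → ℝ) (v : Fin (m * 2) → V)
    {i : Fin m} (hi : ∀ u w, α i u w = 0) : wedgeTwoForms α v = 0 := by
  unfold wedgeTwoForms
  rw [sum_eq_zero, mul_zero]
  intro σ _
  rw [prod_eq_zero (mem_univ i) (hi _ _), mul_zero]

/-- Two-forms commute: `π` acts on both slots of each pair, so the induced permutation has sign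
`(sign π)² = 1`. -/
theorem wedgeTwoForms_comp_perm (α : Fin m → V → V → ℝ) (v : Fin (m * 2) → V)
    (π : Perm (Fin m)) : wedgeTwoForms (fun i ↦ α (π i)) v = wedgeTwoForms α v := by
  unfold wedgeTwoForms
  congr 1
  set ρ : Perm (Fin (m * 2)) :=
    finProdFinEquiv.permCongr (Equiv.prodCongrLeft fun _ : Fin 2 ↦ π) with hρ
  have hsign : Perm.sign ρ = 1 := by
    rw [hρ, Perm.sign_permCongr, Perm.sign_prodCongrLeft]
    simp
  have hρ_apply (i : Fin m) (r : Fin 2) :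
      ρ (finProdFinEquiv (i, r)) = finProdFinEquiv (π i, r) := by
    simp only [hρ, Equiv.permCongr_apply, Equiv.symm_apply_apply]
    simp
  rw [← Equiv.sum_comp (Equiv.mulRight ρ)]
  refine sum_congr rfl fun σ _ ↦ ?_
  simp only [Equiv.coe_mulRight, Perm.sign_mul, hsign, mul_one, Perm.mul_apply, hρ_apply]
  congr 1
  exact Equiv.prod_comp π fun i ↦
    α i (v (σ (finProdFinEquiv (i, 0)))) (v (σ (finProdFinEquiv (i, 1))))

/-- Products of entries of `Ω` along the cycles of a permutation vanish if the diagonal of `Ω`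
vanishes and the indices split into two classes such that `Ω i j` is a wedge multiple of `e i` if
`i` lies in the class `P` or `j` does not, and similarly for `e j`. -/
theorem wedgeTwoForms_cycle_eq_zero {ι : Type*} (Ω : ι → ι → V → V → ℝ) (e : ι → V → ℝ)
    (P : ι → Prop) (hdiag : ∀ i u w, Ω i i u w = 0)
    (hleft : ∀ i j, P i ∨ ¬ P j → IsWedgeMultiple (e i) (Ω i j))
    (hright : ∀ i j, P j ∨ ¬ P i → IsWedgeMultiple (e j) (Ω i j)) (hm : 0 < m) (s : Fin m → ι)
    (τ : Perm (Fin m)) (v : Fin (m * 2) → V) :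
    wedgeTwoForms (fun a ↦ Ω (s a) (s (τ a))) v = 0 := by
  -- An index outside `P` is usable only if its neighbours are outside `P` too, so an index in `P`
  -- is preferred.
  obtain ⟨a, ha⟩ : ∃ a, P (s a) ∨ ∀ b, ¬ P (s b) := by
    by_cases h : ∃ a, P (s a)
    · exact h.imp fun _ ↦ Or.inl
    · exact ⟨⟨0, hm⟩, Or.inr (not_exists.1 h)⟩
  by_cases hτ : τ⁻¹ a = a
  · refine wedgeTwoForms_eq_zero_of_factor_eq_zero _ v (i := a) ?_
    rw [Perm.inv_eq_iff_eq] at hτ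
    rw [← hτ]
    exact hdiag _
  · refine wedgeTwoForms_eq_zero_of_common_factor _ v hτ (e (s a)) ?_
      (hleft _ _ (ha.imp_right fun h ↦ h _))
    rw [show τ (τ⁻¹ a) = a by simp]
    exact hright _ _ (ha.imp_right fun h ↦ h _)

end Wedge

/-! ### Cyclic index sums and traces. -/

section CyclicSums

variable {ι : Type*} [Fintype ι] {m : ℕ}

/-- Cyclicity of the trace along every cycle of `τ` at once: the outer indices and the inner
summation indices exchange roles after a shift by `τ`. -/
theorem sum_prod_matrix_mul_comm {R : Type*} [CommRing R] (P : Matrix ι ι R)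
    (B : Fin m → Matrix ι ι R) (τ : Perm (Fin m)) :
    ∑ s : Fin m → ι, ∏ a, (P * B a) (s a) (s (τ a)) =
      ∑ s : Fin m → ι, ∏ a, (B a * P) (s a) (s (τ a)) := by
  classical
  simp only [Matrix.mul_apply, prod_univ_sum, Fintype.piFinset_univ]
  rw [sum_comm]
  refine sum_congr rfl fun p _ ↦ ?_
  rw [← Equiv.sum_comp (Equiv.arrowCongr τ (Equiv.refl ι))]
  refine sum_congr rfl fun s _ ↦ ?_
  simp only [prod_mul_distrib]
  rw [mul_comm, ← Equiv.prod_comp τ (fun a ↦ P _ (p a))]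
  simp

theorem sum_prod_repr_basis_independent {R V : Type*} [CommRing R] [AddCommGroup V] [Module R V]
    [DecidableEq ι] (e e' : Module.Basis ι R V) (f : Fin m → Module.End R V) (τ : Perm (Fin m)) :
    ∑ s : Fin m → ι, ∏ a, e.repr (f a (e (s (τ a)))) (s a) =
      ∑ s : Fin m → ι, ∏ a, e'.repr (f a (e' (s (τ a)))) (s a) := by
  have h (a : Fin m) : LinearMap.toMatrix e e (f a) =
      e.toMatrix e' * (LinearMap.toMatrix e' e' (f a) * e'.toMatrix e) := by
    rw [← Matrix.mul_assoc, basis_toMatrix_mul_linearMap_toMatrix_mul_basis_toMatrix]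
  simp only [← LinearMap.toMatrix_apply, h]
  rw [sum_prod_matrix_mul_comm]
  simp only [Matrix.mul_assoc, Module.Basis.toMatrix_mul_toMatrix_flip, Matrix.mul_one]

theorem list_prod_ofFn_matrix_apply {R : Type*} [CommRing R] [DecidableEq ι]
    (A : Fin (m + 1) → Matrix ι ι R) (p q : ι) :
    (List.ofFn A).prod p q = ∑ s : Fin m → ι, ∏ a, A a (Fin.cons (α := fun _ ↦ ι) p s a)
      (Fin.snoc (α := fun _ ↦ ι) s q a) := by
  induction m generalizing p with
  | zero => simp [Fin.snoc]
  | succ m ih =>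
    rw [List.ofFn_succ, List.prod_cons, Matrix.mul_apply,
      ← (Fin.consEquiv fun _ : Fin (m + 1) ↦ ι).sum_comp, Fintype.sum_prod_type]
    refine sum_congr rfl fun r _ ↦ ?_
    rw [ih, mul_sum]
    refine sum_congr rfl fun s _ ↦ ?_
    have hcons : (Fin.consEquiv fun _ : Fin (m + 1) ↦ ι) (r, s) = Fin.cons r s := rfl
    rw [hcons, Fin.prod_univ_succ (n := m + 1), ← Fin.cons_snoc_eq_snoc_cons]
    rfl

/-- A trace sums over closed walks, where each step ends at the start of the next; this puts it in
the cycle form with `τ = finRotate`. -/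
theorem trace_list_prod_ofFn {R : Type*} [CommRing R] [DecidableEq ι]
    (A : Fin (m + 1) → Matrix ι ι R) :
    (List.ofFn A).prod.trace =
      ∑ s : Fin (m + 1) → ι, ∏ a, A a (s a) (s (finRotate (m + 1) a)) := by
  rw [← (Fin.consEquiv fun _ : Fin (m + 1) ↦ ι).sum_comp, Fintype.sum_prod_type, Matrix.trace]
  refine sum_congr rfl fun p _ ↦ ?_
  rw [Matrix.diag_apply, list_prod_ofFn_matrix_apply]
  refine sum_congr rfl fun s _ ↦ prod_congr rfl fun a _ ↦ ?_
  rw [Fin.snoc_eq_cons_rotate]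
  rfl

theorem trace_list_prod_ofFn_end {R V : Type*} [CommRing R] [AddCommGroup V] [Module R V]
    [DecidableEq ι] (e : Module.Basis ι R V) (f : Fin (m + 1) → Module.End R V) :
    LinearMap.trace R V (List.ofFn f).prod =
      ∑ s : Fin (m + 1) → ι, ∏ a, e.repr (f a (e (s (finRotate (m + 1) a)))) (s a) := by
  have h : LinearMap.toMatrix e e (List.ofFn f).prod =
      (List.ofFn fun a ↦ LinearMap.toMatrix e e (f a)).prod := by
    have := map_list_prod (LinearMap.toMatrixAlgEquiv e) (List.ofFn f)
    rw [List.map_ofFn] at this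
    exact this
  rw [LinearMap.trace_eq_matrix_trace R e, h, trace_list_prod_ofFn]
  simp only [LinearMap.toMatrix_apply]

end CyclicSums

/-! ### From increasing maps to all maps. -/

section OrderEmbeddings

variable {m n : ℕ}

/-- Every injective map is uniquely an increasing map precomposed with a permutation, found by
sorting. -/
theorem sum_orderEmbedding_eq (H : (Fin m → Fin n) → ℝ)
    (hperm : ∀ (s : Fin m → Fin n) (π : Perm (Fin m)), H (s ∘ π) = H s)
    (hinj : ∀ s : Fin m → Fin n, ¬ Function.Injective s → H s = 0) :
    (m.factorial : ℝ) * ∑ s : Fin m ↪o Fin n, H s = ∑ s : Fin m → Fin n, H s := by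
  classical
  have h1 : (m.factorial : ℝ) * ∑ s : Fin m ↪o Fin n, H s =
      ∑ p : (Fin m ↪o Fin n) × Perm (Fin m), H (p.1 ∘ p.2) := by
    simp only [Fintype.sum_prod_type, hperm, sum_const, card_univ, Fintype.card_perm,
      Fintype.card_fin, nsmul_eq_mul, mul_sum]
  rw [h1, ← sum_filter_of_ne (s := univ) (p := fun s : Fin m → Fin n ↦ Function.Injective s)
    fun s _ hs ↦ by by_contra h; exact hs (hinj s h)]
  refine sum_bij (fun p _ ↦ p.1 ∘ p.2) (fun p _ ↦ ?_) (fun p _ p' _ h ↦ ?_) (fun s hs ↦ ?_)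
    fun p _ ↦ rfl
  · simpa using p.1.injective.comp p.2.injective
  · have hr : Set.range p.1 = Set.range p'.1 := by
      have := congrArg Set.range h
      simpa [Set.range_comp] using this
    have h1 : p.1 = p'.1 := OrderEmbedding.range_inj.1 hr
    refine Prod.ext h1 (Equiv.ext fun a ↦ ?_)
    have := congrFun h a
    simp only [Function.comp_apply, h1] at this
    exact p'.1.injective this
  · have hs : Function.Injective s := by simpa using hs
    have hmono : StrictMono (s ∘ Tuple.sort s) :=
      (Tuple.monotone_sort s).strictMono_of_injective (hs.comp (Tuple.sort s).injective)
    refine ⟨(OrderEmbedding.ofStrictMono _ hmono, (Tuple.sort s)⁻¹), mem_univ _, ?_⟩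
    ext a
    simp

end OrderEmbeddings

/-! ### Basis independence of the sum of principal minors. -/

section PrincipalMinors

variable {V : Type*} {m n : ℕ}

/-- The sum of the principal minors of a matrix of two-forms as a sum over all maps. -/
theorem sum_principal_minors_eq (Ω : Fin n → Fin n → V → V → ℝ) (v : Fin (m * 2) → V) :
    (m.factorial : ℝ) * ∑ s : Fin m ↪o Fin n, ∑ τ : Perm (Fin m), ((Perm.sign τ : ℤ) : ℝ) *
        wedgeTwoForms (fun a ↦ Ω (s a) (s (τ a))) v =
      ∑ s : Fin m → Fin n, ∑ τ : Perm (Fin m), ((Perm.sign τ : ℤ) : ℝ) *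
        wedgeTwoForms (fun a ↦ Ω (s a) (s (τ a))) v := by
  refine sum_orderEmbedding_eq (fun s ↦ ∑ τ : Perm (Fin m), ((Perm.sign τ : ℤ) : ℝ) *
        wedgeTwoForms (fun a ↦ Ω (s a) (s (τ a))) v) (fun s π ↦ ?_) fun s hs ↦ ?_
  -- Relabelling `s` by `π` amounts to conjugating `τ` and reordering the commuting two-forms.
  · rw [← Equiv.sum_comp (MulAut.conj π).toEquiv
      fun τ : Perm (Fin m) ↦ ((Perm.sign τ : ℤ) : ℝ) * wedgeTwoForms (fun a ↦ Ω (s a) (s (τ a))) v]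
    refine sum_congr rfl fun τ _ ↦ ?_
    rw [← wedgeTwoForms_comp_perm (fun a ↦ Ω (s a) (s _)) v π]
    congr 1
    · have h : Perm.sign ((MulAut.conj π).toEquiv τ) = Perm.sign τ := by
        simp [mul_comm (Perm.sign π), mul_assoc]
      rw [h]
    · simp
  -- If `s i = s j`, then `τ ↦ swap i j * τ` keeps the wedge product and flips the sign.
  · simp only [Function.Injective, not_forall] at hs
    obtain ⟨i, j, hs, hij⟩ := hs
    have hswap (a : Fin m) : s (swap i j a) = s a := by
      rcases eq_or_ne a i with rfl | hi
      · rw [swap_apply_left, hs]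
      rcases eq_or_ne a j with rfl | hj
      · rw [swap_apply_right, hs]
      rw [swap_apply_of_ne_of_ne hi hj]
    have h := Equiv.sum_comp (Equiv.mulLeft (swap i j)) fun τ : Perm (Fin m) ↦
      ((Perm.sign τ : ℤ) : ℝ) * wedgeTwoForms (fun a ↦ Ω (s a) (s (τ a))) v
    simp only [Equiv.coe_mulLeft, Perm.mul_apply, hswap, Perm.sign_mul, Perm.sign_swap hij] at h
    simp only [neg_mul, one_mul, Units.val_neg, Int.cast_neg, sum_neg_distrib] at h
    linarith

theorem sum_wedgeTwoForms_eq {ι : Type*} [Fintype ι] (Ω : ι → ι → V → V → ℝ)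
    (v : Fin (m * 2) → V) (τ : Perm (Fin m)) :
    ∑ s : Fin m → ι, wedgeTwoForms (fun a ↦ Ω (s a) (s (τ a))) v =
      (1 / 2 ^ m : ℝ) * ∑ σ : Perm (Fin (m * 2)), ((Perm.sign σ : ℤ) : ℝ) *
        ∑ s : Fin m → ι, ∏ a, Ω (s a) (s (τ a)) (v (σ (finProdFinEquiv (a, 0))))
          (v (σ (finProdFinEquiv (a, 1)))) := by
  simp only [wedgeTwoForms, mul_sum]
  exact sum_comm

/-- Increasing maps do not behave well under a change of basis; after multiplication by `m!` the sum
runs over all maps, and invariance holds for each `τ` separately. -/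
theorem sum_principal_minors_basis_independent [AddCommGroup V] [Module ℝ V]
    (e e' : Module.Basis (Fin n) ℝ V) (R : V → V → Module.End ℝ V) (v : Fin (m * 2) → V) :
    ∑ s : Fin m ↪o Fin n, ∑ τ : Perm (Fin m), ((Perm.sign τ : ℤ) : ℝ) *
        wedgeTwoForms (fun a u w ↦ e.repr (R u w (e (s (τ a)))) (s a)) v =
      ∑ s : Fin m ↪o Fin n, ∑ τ : Perm (Fin m), ((Perm.sign τ : ℤ) : ℝ) *
        wedgeTwoForms (fun a u w ↦ e'.repr (R u w (e' (s (τ a)))) (s a)) v := by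
  have hm : (m.factorial : ℝ) ≠ 0 := by exact_mod_cast m.factorial_ne_zero
  refine mul_left_cancel₀ hm ?_
  rw [sum_principal_minors_eq (fun i j u w ↦ e.repr (R u w (e j)) i) v,
    sum_principal_minors_eq (fun i j u w ↦ e'.repr (R u w (e' j)) i) v]
  refine sum_comm.trans ((sum_congr rfl fun τ _ ↦ ?_).trans sum_comm)
  rw [← mul_sum, ← mul_sum, sum_wedgeTwoForms_eq (fun i j u w ↦ e.repr (R u w (e j)) i) v τ,
    sum_wedgeTwoForms_eq (fun i j u w ↦ e'.repr (R u w (e' j)) i) v τ]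
  congr 2
  refine sum_congr rfl fun σ _ ↦ ?_
  rw [sum_prod_repr_basis_independent e e' (fun a ↦ R (v (σ (finProdFinEquiv (a, 0))))
    (v (σ (finProdFinEquiv (a, 1))))) τ]

end PrincipalMinors

/-! ### Calculus of partial derivatives. -/

section PartialDeriv

variable {n : ℕ} {f h : EuclideanSpace ℝ (Fin n) → ℝ} {y : EuclideanSpace ℝ (Fin n)}

theorem partialDeriv_mul (i : Fin n) (hf : DifferentiableAt ℝ f y) (hh : DifferentiableAt ℝ h y) :
    partialDeriv i (fun z ↦ f z * h z) y =
      partialDeriv i f y * h y + f y * partialDeriv i h y := by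
  simp only [partialDeriv]
  rw [fderiv_fun_mul hf hh]
  simp
  ring

theorem partialDeriv_add (i : Fin n) (hf : DifferentiableAt ℝ f y) (hh : DifferentiableAt ℝ h y) :
    partialDeriv i (fun z ↦ f z + h z) y = partialDeriv i f y + partialDeriv i h y := by
  simp only [partialDeriv]
  rw [fderiv_fun_add hf hh]
  simp

theorem partialDeriv_sum {ι : Type*} (s : Finset ι) (i : Fin n)
    {F : ι → EuclideanSpace ℝ (Fin n) → ℝ} (hF : ∀ l ∈ s, DifferentiableAt ℝ (F l) y) :
    partialDeriv i (fun z ↦ ∑ l ∈ s, F l z) y = ∑ l ∈ s, partialDeriv i (F l) y := by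
  simp only [partialDeriv]
  rw [fderiv_fun_sum hF]
  simp

theorem partialDeriv_congr (i : Fin n) (hfh : f =ᶠ[nhds y] h) :
    partialDeriv i f y = partialDeriv i h y := by
  simp only [partialDeriv, hfh.fderiv_eq]

theorem differentiableAt_partialDeriv (i : Fin n) (hf : ContDiffAt ℝ 2 f y) :
    DifferentiableAt ℝ (partialDeriv i f) y :=
  ((hf.fderiv_right (m := 1) (by norm_num)).differentiableAt (by norm_num)).clm_apply
    (differentiableAt_const _)

theorem partialDeriv_comm (i j : Fin n) (hf : ContDiffAt ℝ 2 f y) :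
    partialDeriv i (partialDeriv j f) y = partialDeriv j (partialDeriv i f) y := by
  have hd : DifferentiableAt ℝ (fderiv ℝ f) y :=
    (hf.fderiv_right (m := 1) (by norm_num)).differentiableAt (by norm_num)
  have h (a b : Fin n) : partialDeriv a (partialDeriv b f) y =
      fderiv ℝ (fderiv ℝ f) y (EuclideanSpace.single a 1) (EuclideanSpace.single b 1) := by
    unfold partialDeriv
    rw [fderiv_clm_apply hd (differentiableAt_const _)]
    simp
  rw [h, h]
  exact (hf.isSymmSndFDerivAt (by simp)).eq _ _

end PartialDeriv

/-! ### Symmetries of the Riemann tensor in coordinates. -/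

section LeviCivita

variable {n : ℕ} (G : EuclideanSpace ℝ (Fin n) → Matrix (Fin n) (Fin n) ℝ)

/-- The Christoffel symbol of the first kind `Γᵢⱼₗ = ½ (∂ᵢ gⱼₗ + ∂ⱼ gᵢₗ - ∂ₗ gᵢⱼ)`. -/
noncomputable def christoffelLower (i j l : Fin n) (y : EuclideanSpace ℝ (Fin n)) : ℝ :=
  (1 / 2 : ℝ) * (partialDeriv i (fun z ↦ G z j l) y + partialDeriv j (fun z ↦ G z i l) y
      - partialDeriv l (fun z ↦ G z i j) y)

variable {G}

theorem christoffel_eq_sum (k i j : Fin n) (y : EuclideanSpace ℝ (Fin n)) :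
    christoffel G k i j y = ∑ l, (G y)⁻¹ k l * christoffelLower G i j l y := by
  simp only [christoffel, christoffelLower, mul_sum]
  exact sum_congr rfl fun l _ ↦ by ring

/-- This is `∇g = 0`. -/
theorem christoffelLower_add_swap (hsymm : ∀ y i j, G y i j = G y j i) (i k q : Fin n)
    (y : EuclideanSpace ℝ (Fin n)) :
    christoffelLower G i k q y + christoffelLower G i q k y =
      partialDeriv i (fun z ↦ G z k q) y := by
  simp only [christoffelLower]
  simp only [hsymm _ q k]
  ring

theorem christoffel_symm (hsymm : ∀ y i j, G y i j = G y j i) (k i j : Fin n) :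
    christoffel G k i j = christoffel G k j i := by
  funext y
  simp only [christoffel, hsymm _ j i]
  congr 1
  exact sum_congr rfl fun l _ ↦ by ring

theorem sum_christoffel_mul (hsymm : ∀ y i j, G y i j = G y j i) {y : EuclideanSpace ℝ (Fin n)}
    (hdet : (G y).det ≠ 0) (i j q : Fin n) :
    ∑ l, christoffel G l i j y * G y l q = christoffelLower G i j q y := by
  have hT : (G y).transpose = G y := by
    ext a b
    exact hsymm y b a
  have hinv : (G y)⁻¹.transpose * G y = 1 := by
    rw [Matrix.transpose_nonsing_inv, hT, Matrix.nonsing_inv_mul _ (isUnit_iff_ne_zero.2 hdet)]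
  simp only [christoffel_eq_sum, sum_mul]
  rw [sum_comm]
  have h (p : Fin n) : ∑ l, (G y)⁻¹ l p * christoffelLower G i j p y * G y l q =
      christoffelLower G i j p y * (1 : Matrix (Fin n) (Fin n) ℝ) p q := by
    rw [← hinv, Matrix.mul_apply, mul_sum]
    exact sum_congr rfl fun l _ ↦ by rw [Matrix.transpose_apply]; ring
  simp only [h, Matrix.one_apply, mul_ite, mul_one, mul_zero, sum_ite_eq', mem_univ, if_true]

variable {y : EuclideanSpace ℝ (Fin n)}

theorem Matrix.differentiableAt_inv_apply {E : Type*} [NormedAddCommGroup E] [NormedSpace ℝ E]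
    {A : E → Matrix (Fin n) (Fin n) ℝ} {y : E}
    (hA : ∀ i j, DifferentiableAt ℝ (fun z ↦ A z i j) y) (hdet : (A y).det ≠ 0) (i j : Fin n) :
    DifferentiableAt ℝ (fun z ↦ (A z)⁻¹ i j) y := by
  have hd {B : E → Matrix (Fin n) (Fin n) ℝ}
      (hB : ∀ i j, DifferentiableAt ℝ (fun z ↦ B z i j) y) :
      DifferentiableAt ℝ (fun z ↦ (B z).det) y := by
    simp only [Matrix.det_apply']
    exact DifferentiableAt.fun_sum fun σ _ ↦ (differentiableAt_const _).mul
      (HasFDerivAt.finsetProd fun k _ ↦ (hB _ _).hasFDerivAt).differentiableAt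
  simp only [Matrix.inv_def, Matrix.smul_apply, Ring.inverse_eq_inv', Matrix.adjugate_apply,
    smul_eq_mul]
  refine ((hd hA).inv hdet).mul (hd fun k l ↦ ?_)
  by_cases hk : k = j
  · subst hk
    simp
  · simpa [Matrix.updateRow_ne hk] using hA k l

theorem differentiableAt_christoffelLower (hG : ∀ i j, ContDiffAt ℝ 2 (fun z ↦ G z i j) y)
    (i j l : Fin n) : DifferentiableAt ℝ (christoffelLower G i j l) y :=
  (((differentiableAt_partialDeriv i (hG j l)).add (differentiableAt_partialDeriv j (hG i l))).sub
    (differentiableAt_partialDeriv l (hG i j))).const_mul _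

theorem differentiableAt_christoffel (hG : ∀ i j, ContDiffAt ℝ 2 (fun z ↦ G z i j) y)
    (hdet : (G y).det ≠ 0) (k i j : Fin n) : DifferentiableAt ℝ (christoffel G k i j) y := by
  rw [show christoffel G k i j = _ from funext fun z ↦ christoffel_eq_sum k i j z]
  exact DifferentiableAt.fun_sum fun l _ ↦ (Matrix.differentiableAt_inv_apply
    (fun a b ↦ (hG a b).differentiableAt (by norm_num)) hdet k l).mul
    (differentiableAt_christoffelLower hG i j l)

/-- Leibniz rule for `Γˡⱼₖ gₗq = Γⱼₖq`, which holds near `y` because `det G ≠ 0` is an open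
condition. -/
theorem sum_partialDeriv_christoffel_mul (hsymm : ∀ y i j, G y i j = G y j i)
    (hG : ∀ i j, ContDiffAt ℝ 2 (fun z ↦ G z i j) y) (hdet : (G y).det ≠ 0) (i j k q : Fin n) :
    ∑ l, partialDeriv i (christoffel G l j k) y * G y l q =
      partialDeriv i (christoffelLower G j k q) y -
        ∑ l, christoffel G l j k y * partialDeriv i (fun z ↦ G z l q) y := by
  have hGd (a b : Fin n) : DifferentiableAt ℝ (fun z ↦ G z a b) y :=
    (hG a b).differentiableAt (by norm_num)
  have hcont : ContinuousAt (fun z ↦ (G z).det) y := by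
    simp only [Matrix.det_apply']
    exact tendsto_finsetSum _ fun σ _ ↦ tendsto_const_nhds.mul
      (tendsto_finsetProd _ fun k _ ↦ (hGd _ _).continuousAt)
  have hev : christoffelLower G j k q =ᶠ[nhds y] fun z ↦ ∑ l, christoffel G l j k z * G z l q := by
    filter_upwards [hcont.eventually_ne hdet] with z hz
    exact (sum_christoffel_mul hsymm hz j k q).symm
  have hΓ (l : Fin n) := differentiableAt_christoffel hG hdet l j k
  rw [partialDeriv_congr i hev, partialDeriv_sum _ i fun l _ ↦ (hΓ l).fun_mul (hGd l q),
    ← sum_sub_distrib]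
  refine sum_congr rfl fun l _ ↦ ?_
  rw [partialDeriv_mul i (hΓ l) (hGd l q)]
  ring

theorem sum_riemannCoord_mul (hsymm : ∀ y i j, G y i j = G y j i)
    (hG : ∀ i j, ContDiffAt ℝ 2 (fun z ↦ G z i j) y) (hdet : (G y).det ≠ 0) (i j k q : Fin n) :
    ∑ l, riemannCoord G i j k l y * G y l q =
      (partialDeriv i (christoffelLower G j k q) y -
        ∑ l, christoffel G l j k y * christoffelLower G i q l y) -
      (partialDeriv j (christoffelLower G i k q) y -
        ∑ l, christoffel G l i k y * christoffelLower G j q l y) := by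
  have key (i j : Fin n) : ∑ l, (partialDeriv i (christoffel G l j k) y +
      ∑ m, christoffel G m j k y * christoffel G l i m y) * G y l q =
      partialDeriv i (christoffelLower G j k q) y -
        ∑ l, christoffel G l j k y * christoffelLower G i q l y := by
    have h : ∑ l, (∑ m, christoffel G m j k y * christoffel G l i m y) * G y l q =
        ∑ m, christoffel G m j k y * christoffelLower G i m q y := by
      simp only [sum_mul, ← sum_christoffel_mul hsymm hdet, mul_sum]
      rw [sum_comm]
      simp only [mul_assoc]
    simp only [add_mul, sum_add_distrib]
    rw [sum_partialDeriv_christoffel_mul hsymm hG hdet, h, sub_add, ← sum_sub_distrib]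
    congr 1
    refine sum_congr rfl fun l _ ↦ ?_
    rw [← christoffelLower_add_swap hsymm i l q]
    ring
  rw [← key i j, ← key j i, ← sum_sub_distrib]
  refine sum_congr rfl fun l _ ↦ ?_
  simp only [riemannCoord, sum_sub_distrib]
  ring

/-- Symmetrizing in `k, q` turns the derivative terms into `∂ᵢ∂ⱼ gₖq - ∂ⱼ∂ᵢ gₖq = 0`, and the
quadratic terms cancel by the symmetry `hC`. -/
theorem sum_riemannCoord_mul_skew (hsymm : ∀ y i j, G y i j = G y j i)
    (hG : ∀ i j, ContDiffAt ℝ 2 (fun z ↦ G z i j) y) (hdet : (G y).det ≠ 0) (i j k q : Fin n) :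
    ∑ l, riemannCoord G i j k l y * G y l q = -∑ l, riemannCoord G i j q l y * G y l k := by
  have hC (i q j k : Fin n) : ∑ l, christoffel G l j k y * christoffelLower G i q l y =
      ∑ l, christoffel G l i q y * christoffelLower G j k l y := by
    simp only [← sum_christoffel_mul hsymm hdet, mul_sum]
    rw [sum_comm]
    refine sum_congr rfl fun l _ ↦ sum_congr rfl fun m _ ↦ ?_
    rw [hsymm y l m]
    ring
  have hd (i j : Fin n) : partialDeriv i (christoffelLower G j k q) y +
      partialDeriv i (christoffelLower G j q k) y =
      partialDeriv i (partialDeriv j fun z ↦ G z k q) y := by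
    rw [← partialDeriv_add i (differentiableAt_christoffelLower hG j k q)
      (differentiableAt_christoffelLower hG j q k)]
    simp only [christoffelLower_add_swap hsymm]
  have h1 := hd i j
  have h2 := hd j i
  have h3 := partialDeriv_comm i j (hG k q)
  rw [sum_riemannCoord_mul hsymm hG hdet, sum_riemannCoord_mul hsymm hG hdet]
  have h4 := hC i q j k
  have h5 := hC j q i k
  linarith

theorem riemannCoord_skew (i j k l : Fin n) :
    riemannCoord G i j k l y = -riemannCoord G j i k l y := by
  simp only [riemannCoord, sum_sub_distrib]
  ring

theorem riemannCoord_bianchi (hsymm : ∀ y i j, G y i j = G y j i) (i j k l : Fin n) :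
    riemannCoord G i j k l y + riemannCoord G j k i l y + riemannCoord G k i j l y = 0 := by
  have h (a : Fin n) := christoffel_symm hsymm a
  simp only [riemannCoord, sum_sub_distrib, h _ k i, h _ k j, h _ j i]
  ring

end LeviCivita

/-! ### Curvature forms of a compatible orthonormal basis. -/

section AlgebraicCurvature

variable {V : Type*} [AddCommGroup V] [Module ℝ V] {B : V →ₗ[ℝ] V →ₗ[ℝ] ℝ}
  {R : V → V → Module.End ℝ V}

theorem curvature_pair_symm (h12 : ∀ u v, R u v = -R v u)
    (h34 : ∀ u v w z, B z (R u v w) = -B w (R u v z))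
    (hcyc : ∀ u v w, R u v w + R v w u + R w u v = 0) (u v w z : V) :
    B z (R u v w) = B v (R w z u) := by
  have hb (u v w z : V) : B z (R u v w) + B z (R v w u) + B z (R w u v) = 0 := by
    rw [← map_add, ← map_add, hcyc, map_zero]
  have h12' (u v w z : V) : B z (R u v w) = -B z (R v u w) := by
    rw [h12 u v, LinearMap.neg_apply, map_neg]
  linarith [hb u v w z, hb v w z u, hb w z u v, hb z u v w, h34 u v w z, h34 v w u z, h34 w u v z,
    h34 v w z u, h34 w z v u, h34 z v w u, h34 w z u v, h34 z u w v, h34 u w z v, h34 z u v w,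
    h34 u v z w, h34 v z u w, h12' w u v z, h12' z v w u, h12' u w z v, h12' v z u w]

variable {n : ℕ} {E : Module.Basis (Fin n) ℝ V}
  (hE : ∀ a b, if a = b then B (E a) (E b) = 1 ∨ B (E a) (E b) = -1 else B (E a) (E b) = 0)

include hE in
theorem apply_basis_eq_mul_repr (a : Fin n) (w : V) :
    B (E a) w = B (E a) (E a) * E.repr w a := by
  conv_lhs => rw [← E.sum_repr w, map_sum]
  rw [Finset.sum_eq_single a]
  · simp [mul_comm]
  · intro b _ hb
    have := hE a b
    rw [if_neg hb.symm] at this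
    simp [this]
  · simp

include hE in
theorem apply_basis_self_mul_self (a : Fin n) : B (E a) (E a) * B (E a) (E a) = 1 := by
  have := hE a a
  rw [if_pos rfl] at this
  rcases this with h | h <;> simp [h]

include hE in
theorem repr_eq_mul_apply_basis (a : Fin n) (w : V) :
    E.repr w a = B (E a) (E a) * B (E a) w := by
  rw [apply_basis_eq_mul_repr hE a w, ← mul_assoc, apply_basis_self_mul_self hE, one_mul]

theorem linearMap_apply_eq_two_terms (L : V →ₗ[ℝ] ℝ) {i j : Fin n} (hij : i ≠ j)
    (hL : ∀ a, a ≠ i → a ≠ j → L (E a) = 0) (w : V) :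
    L w = E.repr w i * L (E i) + E.repr w j * L (E j) := by
  conv_lhs => rw [← E.sum_repr w, map_sum]
  rw [Fintype.sum_eq_add i j hij]
  · simp
  · intro a ha
    simp [hL a ha.1 ha.2]

include hE in
-- Put `E p` in the first slot of the compatibility identity and divide by `B (E p) (E p) = ±1`.
theorem apply_curvature_of_compatible (h12 : ∀ u v, R u v = -R v u) {p : Fin n}
    (hp : ∀ a b c l, B (E p) a * B (E p) (R b c l) + B (E p) b * B (E p) (R c a l)
      + B (E p) c * B (E p) (R a b l) = 0) (u v w : V) :
    B (E p) (R u v w) = E.repr u p * (-B (E p) (R v (E p) w)) -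
      E.repr v p * (-B (E p) (R u (E p) w)) := by
  have h := hp (E p) u v w
  rw [apply_basis_eq_mul_repr hE p u, apply_basis_eq_mul_repr hE p v, h12 (E p) u,
    LinearMap.neg_apply, map_neg] at h
  linear_combination B (E p) (E p) * h - (B (E p) (R u v w) + E.repr u p * B (E p) (R v (E p) w) -
    E.repr v p * B (E p) (R u (E p) w)) * apply_basis_self_mul_self hE p

variable (h12 : ∀ u v, R u v = -R v u) (h34 : ∀ u v w z, B z (R u v w) = -B w (R u v z))
  (hcyc : ∀ u v w, R u v w + R v w u + R w u v = 0)
  (hcomp : ∀ p : Fin n, 2 ≤ (p : ℕ) → ∀ a b c l, B (E p) a * B (E p) (R b c l)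
    + B (E p) b * B (E p) (R c a l) + B (E p) c * B (E p) (R a b l) = 0)

include hE h34 in
theorem repr_curvature_diag (i : Fin n) (u w : V) : E.repr (R u w (E i)) i = 0 := by
  rw [repr_eq_mul_apply_basis hE]
  have := h34 u w (E i) (E i)
  rw [show B (E i) (R u w (E i)) = 0 by linarith, mul_zero]

include hE h12 h34 hcyc hcomp in
-- Every `a ≠ i, j` is compatible, so `R(E j, E i)` has no component along `E a`, and by skewness it
-- kills `E a`. Pair symmetry carries this over to the arguments `u, v`.
theorem apply_curvature_of_small {i j : Fin n} (hi : (i : ℕ) < 2) (hj : (j : ℕ) < 2) (hij : i ≠ j)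
    (u v : V) :
    B (E i) (R u v (E j)) = (E.repr u i * E.repr v j - E.repr u j * E.repr v i) *
      B (E j) (R (E j) (E i) (E i)) := by
  have hbig {a : Fin n} (hai : a ≠ i) (haj : a ≠ j) : 2 ≤ (a : ℕ) := by
    have h1 := Fin.val_ne_of_ne hai
    have h2 := Fin.val_ne_of_ne haj
    have h3 := Fin.val_ne_of_ne hij
    omega
  have hzero (a : Fin n) (hai : a ≠ i) (haj : a ≠ j) (z : V) :
      B (E a) (R (E j) (E i) z) = 0 := by
    rw [apply_curvature_of_compatible hE h12 (hcomp a (hbig hai haj))]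
    simp [hai.symm, haj.symm]
  have hskew := h34 (E j) (E i)
  have h1 (z : V) := linearMap_apply_eq_two_terms (E := E) (B z ∘ₗ R (E j) (E i)) hij
    (fun a hai haj ↦ by
      rw [LinearMap.comp_apply, hskew, hzero a hai haj, neg_zero])
  simp only [LinearMap.comp_apply] at h1
  rw [curvature_pair_symm h12 h34 hcyc, h1 v u, hskew (E i), hskew (E j), h1 (E i) v, h1 (E j) v]
  have h2 := hskew (E i) (E i)
  have h3 := hskew (E j) (E j)
  have h4 := hskew (E i) (E j)
  rw [show B (E i) (R (E j) (E i) (E i)) = 0 by linarith,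
    show B (E j) (R (E j) (E i) (E j)) = 0 by linarith]
  linear_combination (-E.repr u i * E.repr v j) * h4

include hE h12 h34 hcyc hcomp in
theorem isWedgeMultiple_repr_curvature_left (i j : Fin n) (hij : 2 ≤ (i : ℕ) ∨ ¬ 2 ≤ (j : ℕ)) :
    IsWedgeMultiple (fun u ↦ E.repr u i) (fun u v ↦ E.repr (R u v (E j)) i) := by
  by_cases hi : 2 ≤ (i : ℕ)
  · refine ⟨fun v ↦ B (E i) (E i) * -B (E i) (R v (E i) (E j)), fun u v ↦ ?_⟩
    beta_reduce
    rw [repr_eq_mul_apply_basis hE, apply_curvature_of_compatible hE h12 (hcomp i hi)]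
    ring
  by_cases h : i = j
  · subst h
    exact ⟨0, fun u v ↦ by simp [repr_curvature_diag hE h34]⟩
  · refine ⟨fun v ↦ B (E i) (E i) * (E.repr v j * B (E j) (R (E j) (E i) (E i))), fun u v ↦ ?_⟩
    beta_reduce
    rw [repr_eq_mul_apply_basis hE,
      apply_curvature_of_small hE h12 h34 hcyc hcomp (by omega) (by omega) h]
    ring

include hE h12 h34 hcyc hcomp in
-- Skewness gives `Ωⁱⱼ = ± Ωʲᵢ`, which reduces this to the left version.
theorem isWedgeMultiple_repr_curvature_right (i j : Fin n) (hij : 2 ≤ (j : ℕ) ∨ ¬ 2 ≤ (i : ℕ)) :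
    IsWedgeMultiple (fun u ↦ E.repr u j) (fun u v ↦ E.repr (R u v (E j)) i) := by
  obtain ⟨β, hβ⟩ := isWedgeMultiple_repr_curvature_left hE h12 h34 hcyc hcomp j i hij
  refine ⟨fun v ↦ -(B (E i) (E i) * (B (E j) (E j) * β v)), fun u v ↦ ?_⟩
  have h := hβ u v
  beta_reduce at h ⊢
  rw [repr_eq_mul_apply_basis hE] at h
  rw [repr_eq_mul_apply_basis hE, h34]
  linear_combination (-B (E i) (E i) * B (E j) (E j)) * h +
    (B (E i) (E i) * B (E j) (R u v (E i))) * apply_basis_self_mul_self hE j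

include hE h12 h34 hcyc hcomp in
theorem wedgeTwoForms_curvature_cycle_eq_zero {m : ℕ} (hm : 0 < m) (s : Fin m → Fin n)
    (τ : Perm (Fin m)) (v : Fin (m * 2) → V) :
    wedgeTwoForms (fun a u w ↦ E.repr (R u w (E (s (τ a)))) (s a)) v = 0 :=
  wedgeTwoForms_cycle_eq_zero (fun i j u w ↦ E.repr (R u w (E j)) i) (fun i u ↦ E.repr u i)
    (fun i ↦ 2 ≤ (i : ℕ)) (repr_curvature_diag hE h34)
    (isWedgeMultiple_repr_curvature_left hE h12 h34 hcyc hcomp)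
    (isWedgeMultiple_repr_curvature_right hE h12 h34 hcyc hcomp) hm s τ v

include hE h12 h34 hcyc hcomp in
theorem sum_trace_curvature_eq_zero {m : ℕ} (v : Fin ((m + 1) * 2) → V) :
    (1 / 2 ^ (m + 1) : ℝ) * ∑ σ : Perm (Fin ((m + 1) * 2)), ((Perm.sign σ : ℤ) : ℝ) *
      LinearMap.trace ℝ V (List.ofFn fun i : Fin (m + 1) ↦
        R (v (σ (finProdFinEquiv (i, 0)))) (v (σ (finProdFinEquiv (i, 1))))).prod = 0 := by
  simp only [trace_list_prod_ofFn_end E]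
  rw [← sum_wedgeTwoForms_eq (fun i j u w ↦ E.repr (R u w (E j)) i) v (finRotate (m + 1))]
  exact sum_eq_zero fun s _ ↦
    wedgeTwoForms_curvature_cycle_eq_zero hE h12 h34 hcyc hcomp m.succ_pos s _ v

end AlgebraicCurvature

/-! ### The metric in the preferred chart. -/

namespace PseudoRiemannianMetric

variable {n : ℕ} {M : Type*} [TopologicalSpace M] [ChartedSpace (EuclideanSpace ℝ (Fin n)) M]
  [IsManifold (𝓡 n) ∞ M] (g : PseudoRiemannianMetric n M) (x : M)

theorem coordMatrix_symm (y : EuclideanSpace ℝ (Fin n)) (i j : Fin n) :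
    g.coordMatrix x y i j = g.coordMatrix x y j i :=
  g.symm _ _ _

theorem val_congr {b b' : M} (h : b = b') (v w : EuclideanSpace ℝ (Fin n)) :
    g.val b v w = g.val b' v w := by
  subst h
  rfl

theorem coordMatrix_extChartAt (i j : Fin n) :
    g.coordMatrix x (extChartAt (𝓡 n) x x) i j = g.val x (coordBasis x i) (coordBasis x j) := by
  have h : mfderiv 𝓘(ℝ, EuclideanSpace ℝ (Fin n)) (𝓡 n) (extChartAt (𝓡 n) x).symm
      (extChartAt (𝓡 n) x x) = ContinuousLinearMap.id ℝ (EuclideanSpace ℝ (Fin n)) := by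
    have := mfderivWithin_range_extChartAt_symm (I := 𝓡 n) (x := x)
    rw [(𝓡 n).range_eq_univ, mfderivWithin_univ] at this
    exact this
  have h' (k : Fin n) : coordBasis x k = (EuclideanSpace.single k 1 : EuclideanSpace ℝ (Fin n)) := by
    have := congrFun (EuclideanSpace.basisFun (Fin n) ℝ).coe_toBasis k
    rw [EuclideanSpace.basisFun_apply] at this
    exact this
  rw [h', h']
  refine Eq.trans ?_ (g.val_congr (extChartAt_to_inv (I := 𝓡 n) x) _ _)
  have h2 (k : Fin n) := DFunLike.congr_fun h (EuclideanSpace.single k 1)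
  exact congrArg₂ (fun v w : EuclideanSpace ℝ (Fin n) ↦
    g.val ((extChartAt (𝓡 n) x).symm (extChartAt (𝓡 n) x x)) v w) (h2 i) (h2 j)

/-- The coordinate fields are constant in the tangent bundle trivialization at `x`, hence smooth,
and so is `g` evaluated on them. -/
theorem contDiffAt_coordMatrix (i j : Fin n) :
    ContDiffAt ℝ ∞ (fun y ↦ g.coordMatrix x y i j) (extChartAt (𝓡 n) x x) := by
  set e := trivializationAt (EuclideanSpace ℝ (Fin n)) (TangentSpace (𝓡 n)) x with he
  have hsec (v : EuclideanSpace ℝ (Fin n)) : ContMDiffAt (𝓡 n)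
      ((𝓡 n).prod 𝓘(ℝ, EuclideanSpace ℝ (Fin n))) ∞
      (fun b ↦ Bundle.TotalSpace.mk' (EuclideanSpace ℝ (Fin n)) b (e.symmL ℝ b v)) x := by
    refine Bundle.contMDiffAt_totalSpace.2 ⟨contMDiffAt_id,
      (contMDiffAt_const (c := v)).congr_of_eventuallyEq ?_⟩
    filter_upwards [e.open_baseSet.mem_nhds
      (FiberBundle.mem_baseSet_trivializationAt (EuclideanSpace ℝ (Fin n)) _ x)] with b hb
    rw [e.symmL_apply hb, ← he, Bundle.TotalSpace.mk', e.apply_mk_symm hb]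
  have h1 : ContMDiffAt (𝓡 n) 𝓘(ℝ, ℝ) ∞ (fun b ↦ g.val b
      (e.symmL ℝ b (EuclideanSpace.single i 1)) (e.symmL ℝ b (EuclideanSpace.single j 1))) x := by
    have := ContMDiffAt.clm_bundle_apply₂ (F₁ := EuclideanSpace ℝ (Fin n))
      (F₂ := EuclideanSpace ℝ (Fin n)) (F₃ := ℝ) (E₃ := Bundle.Trivial M ℝ) (b := fun b : M ↦ b)
      g.contMDiff.contMDiffAt (hsec (EuclideanSpace.single i 1)) (hsec (EuclideanSpace.single j 1))
    rw [Bundle.contMDiffAt_totalSpace] at this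
    exact this.2
  have h2 := ContMDiffAt.comp (extChartAt (𝓡 n) x x)
    (f := (extChartAt (𝓡 n) x).symm) (by rwa [extChartAt_to_inv])
    ((contMDiffOn_extChartAt_symm (n := ∞) (I := 𝓡 n) x).contMDiffAt (extChartAt_target_mem_nhds x))
  rw [contMDiffAt_iff_contDiffAt] at h2
  refine h2.congr_of_eventuallyEq ?_
  filter_upwards [extChartAt_target_mem_nhds (I := 𝓡 n) x] with y hy
  have hy' : (extChartAt (𝓡 n) x).symm y ∈ (chartAt (EuclideanSpace ℝ (Fin n)) x).source := by
    rw [← extChartAt_source (𝓡 n)]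
    exact (extChartAt (𝓡 n) x).map_target hy
  have h3 := TangentBundle.symmL_trivializationAt (I := 𝓡 n) hy'
  rw [(𝓡 n).range_eq_univ, mfderivWithin_univ, (extChartAt (𝓡 n) x).right_inv hy] at h3
  simp only [Function.comp_apply, he, h3]
  rfl

end PseudoRiemannianMetric

/-! ### Symmetries of the curvature on tangent spaces. -/

namespace PseudoRiemannianMetric

variable {n : ℕ} {M : Type*} [TopologicalSpace M] [ChartedSpace (EuclideanSpace ℝ (Fin n)) M]
  [IsManifold (𝓡 n) ∞ M] (g : PseudoRiemannianMetric n M) (x : M)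

/-- The metric at `x` as a bilinear form. -/
noncomputable def toBilin : TangentSpace (𝓡 n) x →ₗ[ℝ] TangentSpace (𝓡 n) x →ₗ[ℝ] ℝ :=
  LinearMap.mk₂ ℝ (fun v w ↦ g.val x v w) (fun _ _ _ ↦ by rw [map_add]; rfl)
    (fun _ _ _ ↦ by rw [map_smul]; rfl) (fun _ _ _ ↦ map_add _ _ _) (fun _ _ _ ↦ map_smul _ _ _)

@[simp]
theorem toBilin_apply (v w : TangentSpace (𝓡 n) x) : g.toBilin x v w = g.val x v w :=
  rfl

theorem toBilin_eq_sum (v w : TangentSpace (𝓡 n) x) :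
    g.toBilin x v w = ∑ i, ∑ j, (coordBasis x).repr v i * (coordBasis x).repr w j *
      g.coordMatrix x (extChartAt (𝓡 n) x x) i j := by
  conv_lhs => rw [← (coordBasis x).sum_repr v, ← (coordBasis x).sum_repr w]
  simp only [map_sum, map_smul, LinearMap.sum_apply, LinearMap.smul_apply, smul_eq_mul,
    toBilin_apply, coordMatrix_extChartAt, mul_sum, mul_assoc]
  rw [sum_comm]
  exact sum_congr rfl fun i _ ↦ sum_congr rfl fun j _ ↦ by ring

theorem det_coordMatrix_ne_zero : (g.coordMatrix x (extChartAt (𝓡 n) x x)).det ≠ 0 := by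
  intro h
  obtain ⟨v, hv, hGv⟩ := Matrix.exists_vecMul_eq_zero_iff.2 h
  refine hv ?_
  have h0 : (coordBasis x).equivFun.symm v = 0 := by
    refine g.nondegenerate x _ fun w ↦ ?_
    rw [← toBilin_apply, toBilin_eq_sum, sum_comm]
    refine sum_eq_zero fun j _ ↦ ?_
    have hj := congrFun hGv j
    simp only [Matrix.vecMul, dotProduct, Pi.zero_apply] at hj
    have hr (i : Fin n) : (coordBasis x).repr ((coordBasis x).equivFun.symm v) i = v i := by
      rw [← Module.Basis.equivFun_apply, LinearEquiv.apply_symm_apply]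
    simp only [hr]
    rw [← mul_zero ((coordBasis x).repr w j), ← hj, mul_sum]
    exact sum_congr rfl fun i _ ↦ by ring
  exact (coordBasis x).equivFun.symm.map_eq_zero_iff.1 h0

theorem repr_curvature_apply (u v w : TangentSpace (𝓡 n) x) (l : Fin n) :
    (coordBasis x).repr (g.curvature x u v w) l = ∑ i, ∑ j, ∑ k,
      (coordBasis x).repr u i * (coordBasis x).repr v j * (coordBasis x).repr w k *
        riemannCoord (g.coordMatrix x) i j k l (extChartAt (𝓡 n) x x) := by
  rw [curvature, Matrix.repr_toLin]
  simp only [Matrix.mulVec, dotProduct, Matrix.of_apply, sum_mul]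
  rw [sum_comm]
  refine sum_congr rfl fun i _ ↦ ?_
  rw [sum_comm]
  exact sum_congr rfl fun j _ ↦ sum_congr rfl fun k _ ↦ by ring

theorem curvature_skew (u v : TangentSpace (𝓡 n) x) : g.curvature x u v = -g.curvature x v u := by
  refine LinearMap.ext fun w ↦ (coordBasis x).repr.injective (Finsupp.ext fun l ↦ ?_)
  rw [LinearMap.neg_apply, map_neg, Finsupp.neg_apply, repr_curvature_apply, repr_curvature_apply,
    sum_comm]
  simp only [← sum_neg_distrib]
  refine sum_congr rfl fun i _ ↦ sum_congr rfl fun j _ ↦ sum_congr rfl fun k _ ↦ ?_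
  rw [riemannCoord_skew]
  ring

theorem curvature_bianchi (u v w : TangentSpace (𝓡 n) x) :
    g.curvature x u v w + g.curvature x v w u + g.curvature x w u v = 0 := by
  refine (coordBasis x).repr.injective (Finsupp.ext fun l ↦ ?_)
  have hcyc (F : Fin n → Fin n → Fin n → ℝ) :
      ∑ j, ∑ k, ∑ i, F j k i = ∑ i, ∑ j, ∑ k, F j k i := by
    rw [sum_congr rfl fun j _ ↦ sum_comm, sum_comm]
  simp only [map_add, map_zero, Finsupp.add_apply, Finsupp.zero_apply, repr_curvature_apply]
  rw [hcyc fun j k i ↦ (coordBasis x).repr v j * (coordBasis x).repr w k * (coordBasis x).repr u i *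
      riemannCoord (g.coordMatrix x) j k i l (extChartAt (𝓡 n) x x),
    ← hcyc fun i j k ↦ (coordBasis x).repr w k * (coordBasis x).repr u i * (coordBasis x).repr v j *
      riemannCoord (g.coordMatrix x) k i j l (extChartAt (𝓡 n) x x)]
  simp only [← sum_add_distrib]
  refine sum_eq_zero fun i _ ↦ sum_eq_zero fun j _ ↦ sum_eq_zero fun k _ ↦ ?_
  have h := riemannCoord_bianchi (y := extChartAt (𝓡 n) x x) (g.coordMatrix_symm x) i j k l
  linear_combination ((coordBasis x).repr u i * (coordBasis x).repr v j *
    (coordBasis x).repr w k) * h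

theorem toBilin_curvature (u v w z : TangentSpace (𝓡 n) x) :
    g.toBilin x z (g.curvature x u v w) = ∑ i, ∑ j, ∑ k, ∑ q,
      (coordBasis x).repr u i * (coordBasis x).repr v j * (coordBasis x).repr w k *
        (coordBasis x).repr z q * ∑ l, riemannCoord (g.coordMatrix x) i j k l
          (extChartAt (𝓡 n) x x) * g.coordMatrix x (extChartAt (𝓡 n) x x) l q := by
  rw [toBilin_eq_sum]
  simp only [repr_curvature_apply, mul_sum, sum_mul]
  calc _ = ∑ q, ∑ i, ∑ l, ∑ j, ∑ k, _ := sum_congr rfl fun q _ ↦ sum_comm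
    _ = ∑ i, ∑ q, ∑ l, ∑ j, ∑ k, _ := sum_comm
    _ = ∑ i, ∑ q, ∑ j, ∑ l, ∑ k, _ := sum_congr rfl fun i _ ↦ sum_congr rfl fun q _ ↦ sum_comm
    _ = ∑ i, ∑ j, ∑ q, ∑ l, ∑ k, _ := sum_congr rfl fun i _ ↦ sum_comm
    _ = ∑ i, ∑ j, ∑ q, ∑ k, ∑ l, _ := sum_congr rfl fun i _ ↦ sum_congr rfl fun j _ ↦
      sum_congr rfl fun q _ ↦ sum_comm
    _ = ∑ i, ∑ j, ∑ k, ∑ q, ∑ l, _ := sum_congr rfl fun i _ ↦ sum_congr rfl fun j _ ↦ sum_comm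
    _ = _ := ?_
  refine sum_congr rfl fun i _ ↦ sum_congr rfl fun j _ ↦ sum_congr rfl fun k _ ↦
    sum_congr rfl fun q _ ↦ sum_congr rfl fun l _ ↦ ?_
  rw [g.coordMatrix_symm x _ q l]
  ring

theorem toBilin_curvature_skew (u v w z : TangentSpace (𝓡 n) x) :
    g.toBilin x z (g.curvature x u v w) = -g.toBilin x w (g.curvature x u v z) := by
  rw [toBilin_curvature, toBilin_curvature]
  simp only [← sum_neg_distrib]
  refine sum_congr rfl fun i _ ↦ sum_congr rfl fun j _ ↦ ?_
  rw [sum_comm]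
  refine sum_congr rfl fun k _ ↦ sum_congr rfl fun q _ ↦ ?_
  rw [sum_riemannCoord_mul_skew (g.coordMatrix_symm x)
    (fun a b ↦ (g.contDiffAt_coordMatrix x a b).of_le (WithTop.coe_le_coe.2 le_top))
    (g.det_coordMatrix_ne_zero x)]
  ring

variable {g} {X : Fin n → Π x : M, TangentSpace (𝓡 n) x}

theorem IsOrthonormalFrame.exists_basis (hX : g.IsOrthonormalFrame X) (x : M) :
    ∃ E : Module.Basis (Fin n) ℝ (TangentSpace (𝓡 n) x), ∀ a, E a = X a x := by
  have hli : LinearIndependent ℝ fun a ↦ X a x := by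
    rw [Fintype.linearIndependent_iff]
    intro c hc a
    have h := congrArg (g.toBilin x (X a x)) hc
    rw [map_sum, map_zero, Finset.sum_eq_single a] at h
    · rw [map_smul, smul_eq_mul, toBilin_apply] at h
      have := hX x a a
      rw [if_pos rfl] at this
      rcases this with h1 | h1 <;> simpa [h1] using h
    · intro b _ hb
      have := hX x a b
      rw [if_neg hb.symm] at this
      simp [this]
    · simp
  have hcard : Fintype.card (Fin n) = Module.finrank ℝ (TangentSpace (𝓡 n) x) :=
    (Module.finrank_eq_card_basis (coordBasis x)).symm
  -- `basisOfLinearIndependentOfCardEqFinrank` needs a nonempty index type, so `n = 0` is separate.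
  rcases isEmpty_or_nonempty (Fin n) with h | h
  · exact ⟨coordBasis x, fun a ↦ h.elim a⟩
  · exact ⟨basisOfLinearIndependentOfCardEqFinrank hli hcard, fun a ↦ by simp⟩

end PseudoRiemannianMetric

/-! ### Vanishing of the Pontryagin forms. -/

theorem mainTheorem10 {n : ℕ} {M : Type*} [TopologicalSpace M] [T2Space M] [ConnectedSpace M]
    [ChartedSpace (EuclideanSpace ℝ (Fin n)) M] [IsManifold (𝓡 n) ∞ M]
    (g : PseudoRiemannianMetric n M) (X : Fin n → Π x : M, TangentSpace (𝓡 n) x)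
    (hX : g.IsOrthonormalFrame X)
    (hcomp : ∀ a : Fin n, 2 ≤ (a : ℕ) → g.RiemannCompatible (X a)) :
    ∀ (k : ℕ), 1 ≤ k → ∀ (x : M) (v : Fin (2 * k * 2) → TangentSpace (𝓡 n) x),
      (∀ e : Module.Basis (Fin n) ℝ (TangentSpace (𝓡 n) x), g.pontryaginForm k x e v = 0) ∧
        g.pontryaginTraceForm k x v = 0 := by
  intro k hk x v
  obtain ⟨E, hE⟩ := hX.exists_basis x
  have hE' : ∀ a b, if a = b then g.toBilin x (E a) (E b) = 1 ∨ g.toBilin x (E a) (E b) = -1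
      else g.toBilin x (E a) (E b) = 0 := by
    simp only [hE]
    exact hX x
  have hcomp' : ∀ p : Fin n, 2 ≤ (p : ℕ) → ∀ a b c l,
      g.toBilin x (E p) a * g.toBilin x (E p) (g.curvature x b c l)
        + g.toBilin x (E p) b * g.toBilin x (E p) (g.curvature x c a l)
        + g.toBilin x (E p) c * g.toBilin x (E p) (g.curvature x a b l) = 0 := by
    intro p hp
    rw [hE]
    exact hcomp p hp x
  refine ⟨fun e ↦ ?_, ?_⟩
  · unfold PseudoRiemannianMetric.pontryaginForm PseudoRiemannianMetric.curvatureForm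
    rw [sum_principal_minors_basis_independent e E (g.curvature x) v, mul_eq_zero]
    refine Or.inr (Finset.sum_eq_zero fun s _ ↦ Finset.sum_eq_zero fun τ _ ↦ ?_)
    rw [wedgeTwoForms_curvature_cycle_eq_zero hE' (g.curvature_skew x) (g.toBilin_curvature_skew x)
      (g.curvature_bianchi x) hcomp' (by omega), mul_zero]
  · unfold PseudoRiemannianMetric.pontryaginTraceForm
    -- The closed-walk expansion needs at least one factor. The type of `v` involves `2 * k`, so `v`
    -- is reverted before rewriting.
    obtain ⟨m, hm⟩ : ∃ m, 2 * k = m + 1 := ⟨2 * k - 1, by omega⟩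
    revert v
    rw [hm]
    intro v
    exact sum_trace_curvature_eq_zero hE' (g.curvature_skew x) (g.toBilin_curvature_skew x)
      (g.curvature_bianchi x) hcomp' v
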